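/- For a positive integer $R$ let $\mathbb{T}_R=\{e^{2\pi \mathrm{i}k/R} : k=0,1,\dots,R-1\}\subset\mathbb{C}$, and for positive integers $P,R$ let $\mathrm{BH}(P,R)$ denote the set of Butson-type Hadamard matrices of order $P$ and complexity $R$, that is, of all complex $P\times P$ matrices $A$ with all entries in $\mathbb{T}_R$ such that $AA^{\mathsf H}=P\,\mathbf{I}_P$, where $A^{\mathsf H}$ is the conjugate transpose of $A$ and $\mathbf{I}_P$ the $P\times P$ identity matrix. Then for all positive integers $\kappa\le 32$ and all integers $r\ge 2$, the set $\mathrm{BH}(2\kappa,2^r)$ is non-empty. -/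

import Mathlib

/-- The set `𝕋_R = {e^{2πi k/R} : k = 0, …, R - 1}` of complex numbers. -/
def rootSet (R : ℕ) : Set ℂ :=
  {z | ∃ k : ℕ, k < R ∧ z = Complex.exp (2 * (Real.pi : ℂ) * Complex.I * (k : ℂ) / (R : ℂ))}

/-- `BH(P, R)`: the Butson-type Hadamard matrices of order `P` and complexity `R`, that is, the
complex `P × P` matrices `A` with all entries in `𝕋_R` and `A Aᴴ = P • I`. -/
def BH (P R : ℕ) : Set (Matrix (Fin P) (Fin P) ℂ) :=
  {A | (∀ i j, A i j ∈ rootSet R) ∧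
    A * A.conjTranspose = (P : ℂ) • (1 : Matrix (Fin P) (Fin P) ℂ)}

open Matrix Kronecker

/-! Since 4 divides `2 ^ r`, fourth roots of unity suffice, and exact arithmetic in `ℤ[i]` makes
orthogonality decidable. A Kronecker product with the order-2 Hadamard matrix doubles the order, so
only odd `κ ≤ 31` need a direct construction: two circulant blocks built from Williamson sequences.
-/

/-- A quaternary complex Hadamard matrix: the entries are fourth roots of unity in `ℤ[i]`, and the
rows are pairwise orthogonal. -/
def IsQuaternaryHadamard {ι : Type*} [Fintype ι] [DecidableEq ι]
    (M : Matrix ι ι GaussianInt) : Prop :=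
  (∀ i j, M i j ^ 4 = 1) ∧ M * Mᴴ = (Fintype.card ι : GaussianInt) • (1 : Matrix ι ι GaussianInt)

theorem IsQuaternaryHadamard.reindex {ι ι' : Type*} [Fintype ι] [DecidableEq ι] [Fintype ι']
    [DecidableEq ι'] {M : Matrix ι ι GaussianInt} (hM : IsQuaternaryHadamard M) (e : ι ≃ ι') :
    IsQuaternaryHadamard (Matrix.reindex e e M) := by
  refine ⟨fun i j => hM.1 _ _, ?_⟩
  rw [Matrix.reindex_apply, conjTranspose_submatrix, submatrix_mul_equiv, hM.2,
    ← Fintype.card_congr e]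
  refine Matrix.ext fun i j => ?_
  simp only [submatrix_apply, Matrix.smul_apply, one_apply, EmbeddingLike.apply_eq_iff_eq]

theorem IsQuaternaryHadamard.kronecker {ι ι' : Type*} [Fintype ι] [DecidableEq ι] [Fintype ι']
    [DecidableEq ι'] {M : Matrix ι ι GaussianInt} {N : Matrix ι' ι' GaussianInt}
    (hM : IsQuaternaryHadamard M) (hN : IsQuaternaryHadamard N) :
    IsQuaternaryHadamard (M ⊗ₖ N) := by
  refine ⟨fun i j => ?_, ?_⟩
  · rw [kronecker_apply, mul_pow, hM.1, hN.1, one_mul]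
  · rw [conjTranspose_kronecker, ← mul_kronecker_mul, hM.2, hN.2, smul_kronecker,
      kronecker_smul, one_kronecker_one, smul_smul, Fintype.card_prod, Nat.cast_mul]

theorem isQuaternaryHadamard_sylvester :
    IsQuaternaryHadamard (!![1, 1; 1, -1] : Matrix (Fin 2) (Fin 2) GaussianInt) := by
  unfold IsQuaternaryHadamard
  decide +kernel

/-- The two-circulant construction: sequences whose periodic autocorrelations are complementary
give a quaternary Hadamard matrix of twice their length. -/
theorem isQuaternaryHadamard_twoCirculant {n : ℕ} [NeZero n] {a b : Fin n → GaussianInt}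
    (ha : ∀ i, a i ^ 4 = 1) (hb : ∀ i, b i ^ 4 = 1)
    (hab : ∀ s, ∑ j, (a (s - j) * star (a (-j)) + b (s - j) * star (b (-j))) =
      if s = 0 then (2 * n : GaussianInt) else 0) :
    IsQuaternaryHadamard (fromBlocks (circulant a) (circulant b)
      (-(circulant b)ᴴ) (circulant a)ᴴ) := by
  have hsum : circulant a * (circulant a)ᴴ + circulant b * (circulant b)ᴴ =
      (2 * n : GaussianInt) • (1 : Matrix (Fin n) (Fin n) GaussianInt) := by
    simp only [conjTranspose_circulant, circulant_mul]
    refine Matrix.ext fun i j => ?_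
    have h := hab (i - j)
    rw [Finset.sum_add_distrib] at h
    simpa [circulant_apply, mulVec, dotProduct, one_apply, sub_eq_zero] using h
  have hcomm : ∀ u v : Fin n → GaussianInt,
      circulant u * (circulant v)ᴴ = (circulant v)ᴴ * circulant u := fun u v => by
    rw [conjTranspose_circulant, circulant_mul_comm]
  refine ⟨?_, ?_⟩
  · have hstar : ∀ z : GaussianInt, z ^ 4 = 1 → star z ^ 4 = 1 := fun z hz => by
      rw [← star_pow, hz, star_one]
    rintro (i | i) (j | j)
    · exact ha _
    · exact hb _
    · simpa [(by decide : Even 4).neg_pow] using hstar _ (hb _)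
    · exact hstar _ (ha _)
  · rw [fromBlocks_conjTranspose, fromBlocks_multiply]
    simp only [conjTranspose_neg, conjTranspose_conjTranspose, Matrix.mul_neg, Matrix.neg_mul,
      neg_neg]
    -- The off-diagonal blocks cancel because circulants commute.
    rw [hsum, ← hcomm b b, ← hcomm a a, add_comm (circulant b * _), hsum,
      circulant_mul_comm b a, ← conjTranspose_mul, ← conjTranspose_mul, circulant_mul_comm b a,
      neg_add_cancel, neg_add_cancel, Fintype.card_sum, Fintype.card_fin, ← fromBlocks_one,
      fromBlocks_smul, smul_zero]
    push_cast
    rw [two_mul]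

/-- For bits `x` and `y`, the fourth root of unity `(ε + δ) / 2 + i (ε - δ) / 2`, where
`ε = (-1) ^ x` and `δ = (-1) ^ y`. -/
def quaternaryUnit : Bool → Bool → GaussianInt
  | false, false => 1
  | true, true => -1
  | false, true => ⟨0, 1⟩
  | true, false => ⟨0, -1⟩

theorem quaternaryUnit_pow_four (x y : Bool) : quaternaryUnit x y ^ 4 = 1 := by
  cases x <;> cases y <;> decide

/-- The quaternary sequence attached to two `±1`-sequences, each given by the bit mask of its
negative entries. -/
def quaternarySeq (n x y : ℕ) (j : Fin n) : GaussianInt :=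
  quaternaryUnit (x.testBit j) (y.testBit j)

/-- The bit masks of four symmetric Williamson sequences of odd length `n ≤ 31`. -/
def williamsonMasks : ℕ → ℕ × ℕ × ℕ × ℕ
  | 1 => (0, 0, 0, 0)
  | 3 => (6, 6, 6, 0)
  | 5 => (30, 12, 30, 18)
  | 7 => (24, 66, 102, 66)
  | 9 => (180, 258, 462, 390)
  | 11 => (876, 1542, 1950, 1290)
  | 13 => (1224, 7182, 3372, 2580)
  | 15 => (22938, 30750, 21066, 3120)
  | 17 => (88938, 62652, 7392, 19656)
  | 19 => (427542, 376890, 362778, 78024)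
  | 21 => (429144, 1867854, 692820, 1008060)
  | 23 => (2824404, 7873566, 1205832, 4105596)
  | 25 => (29896782, 15354204, 16436604, 2575248)
  | 27 => (11821776, 98066874, 11821776, 36150852)
  | 29 => (444645462, 434771430, 415970502, 73277064)
  | 31 => (1948353582, 1164449442, 2093634366, 847003212)
  | _ => (0, 0, 0, 0)

/-- Symmetric `±1`-sequences `x`, `y` have real Fourier transforms, so `((1 + i) x + (1 - i) y) / 2`
has power spectrum `(x̂² + ŷ²) / 2`. Williamson's condition that the four squared transforms sum to
`4n` thus becomes `2n` for the two quaternary sequences. The finitely many identities are evaluated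
directly. -/
theorem williamsonMasks_autocorrelation (m : Fin 16) (s : Fin (2 * m + 1)) :
    let w := williamsonMasks (2 * m + 1)
    let a := quaternarySeq (2 * m + 1) w.1 w.2.1
    let b := quaternarySeq (2 * m + 1) w.2.2.1 w.2.2.2
    ∑ j, (a (s - j) * star (a (-j)) + b (s - j) * star (b (-j))) =
      if s = 0 then (2 * (2 * m + 1 : ℕ) : GaussianInt) else 0 := by
  revert m
  decide +kernel

theorem exists_isQuaternaryHadamard (κ : ℕ) (hκ : 1 ≤ κ) (hκ' : κ ≤ 32) :
    ∃ M : Matrix (Fin (2 * κ)) (Fin (2 * κ)) GaussianInt, IsQuaternaryHadamard M := by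
  induction κ using Nat.strong_induction_on with
  | _ κ ih =>
    obtain ⟨m, rfl | rfl⟩ := Nat.even_or_odd' κ
    · obtain ⟨M, hM⟩ := ih m (by omega) (by omega) (by omega)
      exact ⟨_, (isQuaternaryHadamard_sylvester.kronecker hM).reindex finProdFinEquiv⟩
    · let w := williamsonMasks (2 * m + 1)
      have hM := isQuaternaryHadamard_twoCirculant
        (a := quaternarySeq (2 * m + 1) w.1 w.2.1)
        (b := quaternarySeq (2 * m + 1) w.2.2.1 w.2.2.2)
        (fun _ => quaternaryUnit_pow_four _ _) (fun _ => quaternaryUnit_pow_four _ _)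
        (williamsonMasks_autocorrelation ⟨m, by omega⟩)
      exact ⟨_, hM.reindex (finSumFinEquiv.trans (finCongr (two_mul _).symm))⟩

theorem mem_rootSet_of_pow_eq_one {R : ℕ} (hR : R ≠ 0) {z : ℂ} (hz : z ^ R = 1) :
    z ∈ rootSet R := by
  have : NeZero R := ⟨hR⟩
  obtain ⟨k, hk, rfl⟩ := (Complex.isPrimitiveRoot_exp R hR).eq_pow_of_pow_eq_one hz
  refine ⟨k, hk, ?_⟩
  rw [← Complex.exp_nat_mul]
  ring_nf

theorem IsQuaternaryHadamard.map_mem_BH {P r : ℕ} {M : Matrix (Fin P) (Fin P) GaussianInt}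
    (hM : IsQuaternaryHadamard M) (hr : 2 ≤ r) :
    M.map GaussianInt.toComplex ∈ BH P (2 ^ r) := by
  refine ⟨fun i j => mem_rootSet_of_pow_eq_one (by positivity) ?_, ?_⟩
  · obtain ⟨k, rfl⟩ := Nat.exists_eq_add_of_le hr
    rw [map_apply, ← map_pow, pow_add, pow_mul, show 2 ^ 2 = 4 from rfl, hM.1, one_pow, map_one]
  · rw [← conjTranspose_map _ fun z => GaussianInt.toComplex_star z, ← Matrix.map_mul, hM.2]
    ext i j
    by_cases h : i = j <;> simp [one_apply, h]

theorem corollary1 (κ r : ℕ) (hκ : 1 ≤ κ) (hκ' : κ ≤ 32) (hr : 2 ≤ r) :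
    (BH (2 * κ) (2 ^ r)).Nonempty := by
  obtain ⟨M, hM⟩ := exists_isQuaternaryHadamard κ hκ hκ'
  exact ⟨_, hM.map_mem_BH hr⟩
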